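/- \textbf{Conventions.} Measurability is with respect to the Lebesgue $\sigma$-algebra and $\lambda$ is Lebesgue measure. A \emph{graphon} is a measurable function $W:[0,1]^2\to[0,1]$ with $W(x,y)=W(y,x)$. For a finite partition $\mathcal P=\{S_1,\dots,S_n\}$ of $[0,1]$ into measurable sets, $W_{\mathcal P}$ is the graphon given by \[W_{\mathcal P}(x,y)=\frac{1}{\lambda(S_i)\lambda(S_j)}\int_{S_i\times S_j}W(u,v)\,du\,dv\qquad(x\in S_i,\ y\in S_j),\] with the value $0$ if $\lambda(S_i)\lambda(S_j)=0$. For a bounded measurable $f:[0,1]\to\mathbb R^2$ let $I_f(x,y,z,w)=1$ if the segments $\mathrm{conv}\{f(x),f(y)\}$ and $\mathrm{conv}\{f(z),f(w)\}$ intersect, and $I_f(x,y,z,w)=0$ otherwise. The \emph{rectilinear crossing density} of $W$ is \[\overline{\mathrm{cd}}(W)=\inf_f\ \frac18\int_{[0,1]^4}W(x_1,x_2)W(x_3,x_4)I_f(x_1,x_2,x_3,x_4)\,dx_1dx_2dx_3dx_4,\] the infimum being over all bounded measurable $f:[0,1]\to\mathbb R^2$. A \emph{simple graphon drawing} $\mathcal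 D$ assigns to every $(x,y)\in[0,1]^2$ a continuous curve $\mathcal D(x,y):[0,1]\to\mathbb R^2$ that is either simple (injective) or constant, such that: (1) $\mathcal D(x,y)(t)=\mathcal D(y,x)(1-t)$ for all $x,y,t\in[0,1]$; (2) for every $x$ the image of $\mathcal D(x,x)$ is a single point, denoted $\mathcal D(x)$; (3) $\mathcal D(x,y)(0)=\mathcal D(x)$ for all $x,y$; (4) for all $x_1,y_1,x_2,y_2$, if the images of $\mathcal D(x_1,y_1)$ and $\mathcal D(x_2,y_2)$ are different sets, then they have at most one point in common. Let $I_{\mathcal D}(x,y,z,w)=1$ if the images of $\mathcal D(x,y)$ and $\mathcal D(z,w)$ have a common point, and $0$ otherwise. The \emph{crossing density} of $W$ is \[\mathrm{cd}(W)=\inf_{\mathcal D}\ \frac18\int_{[0,1]^4}W(x_1,x_2)W(x_3,x_4)I_{\mathcal D}(x_1,x_2,x_3,x_4)\,dx_1dx_2dx_3dx_4,\] the infimum being over all simple graphon drawings $\mathcal D$ for which $I_{\mathcal D}$ is measurable. \textbf{Theorem.} Let $W$ be a graphon and $\mathcal P=\{S_1,\dots,S_n\}$ a finite partition of $[0,1]$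 into measurable sets. Then \[\overline{\mathrm{cd}}(W)\le\overline{\mathrm{cd}}(W_{\mathcal P})\qquad\text{and}\qquad \mathrm{cd}(W)\le\mathrm{cd}(W_{\mathcal P}).\] -/

import Mathlib

open MeasureTheory Set
open scoped unitInterval

noncomputable section

/- Throughout, `I = [0,1]` carries Lebesgue measure `volume`, and `I × I`, `I × I × I × I` carry the
product measures.  Measurability is with respect to the Lebesgue (completed) σ-algebra: a set is
Lebesgue measurable iff it is `NullMeasurableSet`, and a real- or plane-valued function is
Lebesgue measurable iff it is `AEMeasurable` for `volume`. -/

/-- The Euclidean plane. -/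
abbrev Plane : Type := EuclideanSpace ℝ (Fin 2)

/-- A graphon: a symmetric Lebesgue measurable function `[0,1]² → [0,1]`. -/
structure Graphon where
  toFun : I → I → ℝ
  aemeasurable' : AEMeasurable (fun p : I × I => toFun p.1 p.2) volume
  symm' : ∀ x y, toFun x y = toFun y x
  mem_Icc' : ∀ x y, toFun x y ∈ Icc (0 : ℝ) 1

instance : CoeFun Graphon (fun _ => I → I → ℝ) := ⟨Graphon.toFun⟩

/-- A partition `S₁, …, Sₙ` of the unit interval into measurable sets
(parts of measure zero are allowed). -/
structure UnitPartition (n : ℕ) where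
  part : Fin n → Set I
  measurable_part : ∀ i, NullMeasurableSet (part i) volume
  disjoint_part : ∀ i j, i ≠ j → Disjoint (part i) (part j)
  cover : ⋃ i, part i = univ

/-- The index of the part containing a given point. -/
def UnitPartition.index {n : ℕ} (P : UnitPartition n) (x : I) : Fin n :=
  Classical.choose (mem_iUnion.1 (P.cover.symm ▸ mem_univ x : x ∈ ⋃ i, P.part i))

theorem UnitPartition.mem_part_index {n : ℕ} (P : UnitPartition n) (x : I) :
    x ∈ P.part (P.index x) :=
  Classical.choose_spec (mem_iUnion.1 (P.cover.symm ▸ mem_univ x : x ∈ ⋃ i, P.part i))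

theorem UnitPartition.index_eq_iff {n : ℕ} (P : UnitPartition n) (x : I) (i : Fin n) :
    P.index x = i ↔ x ∈ P.part i := by
  constructor
  · rintro rfl
    exact P.mem_part_index x
  · intro hx
    by_contra h
    exact disjoint_left.1 (P.disjoint_part _ _ h) (P.mem_part_index x) hx

/-- The average of `W` over the cell `Sᵢ × Sⱼ`:
`(λ(Sᵢ) λ(Sⱼ))⁻¹ ∫_{Sᵢ × Sⱼ} W` (it is `0` if the cell is null). -/
def Graphon.cellAverage (W : Graphon) {n : ℕ} (P : UnitPartition n) (i j : Fin n) : ℝ :=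
  (∫ p in P.part i ×ˢ P.part j, W p.1 p.2) /
    (volume.real (P.part i) * volume.real (P.part j))

theorem Graphon.cellAverage_mem_Icc (W : Graphon) {n : ℕ} (P : UnitPartition n) (i j : Fin n) :
    W.cellAverage P i j ∈ Icc (0 : ℝ) 1 := by
  have h0 : 0 ≤ ∫ p in P.part i ×ˢ P.part j, W p.1 p.2 :=
    integral_nonneg fun p => (W.mem_Icc' p.1 p.2).1
  have h1 : ∫ p in P.part i ×ˢ P.part j, W p.1 p.2 ≤
      volume.real (P.part i) * volume.real (P.part j) := by
    have hle : ∫ p in P.part i ×ˢ P.part j, W p.1 p.2 ≤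
        ∫ _p in P.part i ×ˢ P.part j, (1 : ℝ) :=
      integral_mono_of_nonneg (Filter.Eventually.of_forall fun p => (W.mem_Icc' p.1 p.2).1)
        (integrable_const 1) (Filter.Eventually.of_forall fun p => (W.mem_Icc' p.1 p.2).2)
    refine hle.trans (le_of_eq ?_)
    rw [setIntegral_const, smul_eq_mul, mul_one, Measure.volume_eq_prod, measureReal_prod_prod]
  exact ⟨div_nonneg h0 (by positivity), div_le_one_of_le₀ h1 (by positivity)⟩

theorem Graphon.cellAverage_symm (W : Graphon) {n : ℕ} (P : UnitPartition n) (i j : Fin n) :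
    W.cellAverage P i j = W.cellAverage P j i := by
  unfold Graphon.cellAverage
  congr 1
  · rw [Measure.volume_eq_prod,
      ← setIntegral_prod_swap (P.part j) (P.part i) (fun p : I × I => W p.1 p.2)]
    exact integral_congr_ae (Filter.Eventually.of_forall fun p => W.symm' _ _)
  · exact mul_comm _ _

theorem UnitPartition.aemeasurable_index {n : ℕ} (P : UnitPartition n) :
    AEMeasurable P.index (volume : Measure I) := by
  refine NullMeasurable.aemeasurable fun s _ => ?_
  have : P.index ⁻¹' s = ⋃ i ∈ s, P.part i := by
    ext x
    simp only [mem_preimage, mem_iUnion, exists_prop, ← P.index_eq_iff]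
    exact ⟨fun h => ⟨_, h, rfl⟩, fun ⟨i, hi, h⟩ => h ▸ hi⟩
  rw [this]
  exact NullMeasurableSet.biUnion (to_countable s) fun i _ => P.measurable_part i

/-- The stepped graphon `W_P`: on `Sᵢ × Sⱼ` it is the average of `W` over that cell. -/
def Graphon.average (W : Graphon) {n : ℕ} (P : UnitPartition n) : Graphon where
  toFun x y := W.cellAverage P (P.index x) (P.index y)
  aemeasurable' := by
    have h1 : AEMeasurable (fun p : I × I => P.index p.1) (volume : Measure (I × I)) :=
      P.aemeasurable_index.comp_quasiMeasurePreserving Measure.quasiMeasurePreserving_fst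
    have h2 : AEMeasurable (fun p : I × I => P.index p.2) (volume : Measure (I × I)) :=
      P.aemeasurable_index.comp_quasiMeasurePreserving Measure.quasiMeasurePreserving_snd
    exact (measurable_of_countable
      (fun q : Fin n × Fin n => W.cellAverage P q.1 q.2)).comp_aemeasurable (h1.prodMk h2)
  symm' x y := W.cellAverage_symm P _ _
  mem_Icc' x y := W.cellAverage_mem_Icc P _ _

/-- `(1/8) ∫_{[0,1]⁴} W(x₁,x₂) W(x₃,x₄) 1_A(x₁,x₂,x₃,x₄) dx₁ dx₂ dx₃ dx₄`. -/
def Graphon.pairDensity (W : Graphon) (A : Set (I × I × I × I)) : ℝ :=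
  (1 / 8) * ∫ q : I × I × I × I, W q.1 q.2.1 * W q.2.2.1 q.2.2.2 * A.indicator 1 q

/-! ### Rectilinear crossing density -/

/-- The family of bounded Lebesgue measurable functions `[0,1] → ℝ²`. -/
structure RectilinearDrawing where
  toFun : I → Plane
  aemeasurable' : AEMeasurable toFun volume
  bounded' : Bornology.IsBounded (range toFun)

/-- The quadruples `(x,y,z,w)` such that the segments `conv{f x, f y}` and `conv{f z, f w}`
intersect. -/
def RectilinearDrawing.meetSet (f : RectilinearDrawing) : Set (I × I × I × I) :=
  {q | (convexHull ℝ {f.toFun q.1, f.toFun q.2.1} ∩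
    convexHull ℝ {f.toFun q.2.2.1, f.toFun q.2.2.2}).Nonempty}

/-- The rectilinear crossing density of a graphon. -/
def Graphon.rectilinearCrossingDensity (W : Graphon) : ℝ :=
  ⨅ f : RectilinearDrawing, W.pairDensity f.meetSet

/-! ### Crossing density -/

/-- A simple graphon drawing: a symmetric family of simple or constant plane curves `D(x,y)`, from
the point `D(x)` to the point `D(y)`, such that any two of the curves with distinct images share
at most one point. -/
structure SimpleGraphonDrawing where
  curve : I → I → C(I, Plane)
  simple_or_const : ∀ x y, Function.Injective (curve x y) ∨ ∃ p, ∀ t, curve x y t = p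
  reverse : ∀ x y t, curve x y t = curve y x (σ t)
  diag : ∀ x, ∃ p, range (curve x x) = {p}
  start : ∀ x y, range (curve x x) = {curve x y 0}
  meet : ∀ x₁ y₁ x₂ y₂, range (curve x₁ y₁) ≠ range (curve x₂ y₂) →
    (range (curve x₁ y₁) ∩ range (curve x₂ y₂)).Subsingleton

/-- The quadruples `(x,y,z,w)` such that `D(x,y)` and `D(z,w)` have a common point. -/
def SimpleGraphonDrawing.meetSet (D : SimpleGraphonDrawing) : Set (I × I × I × I) :=
  {q | (range (D.curve q.1 q.2.1) ∩ range (D.curve q.2.2.1 q.2.2.2)).Nonempty}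

/-- The crossing density of a graphon: the infimum ranges over the simple graphon drawings for
which the indicator of "`D(x,y)` meets `D(z,w)`" is Lebesgue measurable. -/
def Graphon.crossingDensity (W : Graphon) : ℝ :=
  ⨅ D : {D : SimpleGraphonDrawing // NullMeasurableSet D.meetSet volume},
    W.pairDensity D.1.meetSet

end

/-! The argument is probabilistic. Fix a drawing whose set `A` of meeting quadruples is measurable.
Label each point of the unit interval by its part of `P` and its bin of length `1 / N`, and for
every label `k` pick an independent random point `ω k`, uniform in the part named by `k`. Redraw
each `x` at the place of `ω (l x)`, where `l x` is its label.

For a quadruple with four distinct labels, the chance of landing in `A` is the proportion of `A` in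
the product of its four parts. This depends only on the parts, so integrating it against `W(x₁,x₂)
W(x₃,x₄)` sees only the cell averages of `W` and returns exactly the density of `A` for the stepped
graphon (`Graphon.pairDensity_average`). Quadruples with a repeated label have measure at most `6 /
N`. Hence some outcome `ω` is within `1 / N` of the stepped density
(`Graphon.exists_pairDensity_preimage_le`).

The bins make repeated labels rare while keeping the labels finite in number, so that every
redrawing is measurable. Nothing about crossings is used except that drawings can be pulled back
along such maps. -/

noncomputable section

/-! ### Quadruples and independent sampling -/

/-- A map applied to the four entries of a quadruple. -/
def mapQuad {α β : Type*} (f : α → β) (q : α × α × α × α) : β × β × β × β :=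
  (f q.1, f q.2.1, f q.2.2.1, f q.2.2.2)

/-- The four entries of a quadruple are pairwise distinct. -/
def PairwiseNe {α : Type*} (q : α × α × α × α) : Prop :=
  q.1 ≠ q.2.1 ∧ q.1 ≠ q.2.2.1 ∧ q.1 ≠ q.2.2.2 ∧ q.2.1 ≠ q.2.2.1 ∧ q.2.1 ≠ q.2.2.2 ∧
    q.2.2.1 ≠ q.2.2.2

/-- The product of four measures from a family. -/
def quadMeasure {κ α : Type*} [MeasurableSpace α] (ν : κ → Measure α) (c : κ × κ × κ × κ) :
    Measure (α × α × α × α) :=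
  (ν c.1).prod ((ν c.2.1).prod ((ν c.2.2.1).prod (ν c.2.2.2)))

theorem aemeasurable_mapQuad {β : Type*} [MeasurableSpace β] {f : I → β}
    (hf : AEMeasurable f volume) :
    AEMeasurable (mapQuad f) (volume : Measure (I × I × I × I)) := by
  have h1 : Measure.QuasiMeasurePreserving (fun q : I × I × I × I => q.1) volume volume :=
    Measure.quasiMeasurePreserving_fst
  have h : Measure.QuasiMeasurePreserving (fun q : I × I × I × I => q.2) volume volume :=
    Measure.quasiMeasurePreserving_snd
  have h' : Measure.QuasiMeasurePreserving (fun q : I × I × I => q.1) volume volume :=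
    Measure.quasiMeasurePreserving_fst
  have k : Measure.QuasiMeasurePreserving (fun q : I × I × I => q.2) volume volume :=
    Measure.quasiMeasurePreserving_snd
  have k1 : Measure.QuasiMeasurePreserving (fun q : I × I => q.1) volume volume :=
    Measure.quasiMeasurePreserving_fst
  have k2 : Measure.QuasiMeasurePreserving (fun q : I × I => q.2) volume volume :=
    Measure.quasiMeasurePreserving_snd
  exact (hf.comp_quasiMeasurePreserving h1).prodMk
    ((hf.comp_quasiMeasurePreserving (h'.comp h)).prodMk
      ((hf.comp_quasiMeasurePreserving (k1.comp (k.comp h))).prodMk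
        (hf.comp_quasiMeasurePreserving (k2.comp (k.comp h)))))

theorem integral_mul_comp_eq_sum {X C : Type*} [MeasurableSpace X] [Fintype C]
    [MeasurableSpace C] [MeasurableSingletonClass C] {μ : Measure X} {g : X → ℝ}
    (hg : Integrable g μ) {L : X → C} (hL : AEMeasurable L μ) (h : C → ℝ) :
    ∫ q, g q * h (L q) ∂μ = ∑ c, h c * ∫ q in L ⁻¹' {c}, g q ∂μ := by
  classical
  have hs : ∀ c, NullMeasurableSet (L ⁻¹' {c}) μ := fun c =>
    hL.nullMeasurable (measurableSet_singleton c)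
  have heq : (fun q => g q * h (L q)) =
      fun q => ∑ c, h c * (L ⁻¹' {c}).indicator g q := by
    funext q
    rw [Finset.sum_eq_single (L q)]
    · simp [mul_comm]
    · intro c _ hc
      rw [indicator_of_notMem (by simpa using hc.symm), mul_zero]
    · simp
  rw [heq, integral_finsetSum _ fun c _ => (hg.indicator₀ (hs c)).const_mul _]
  refine Finset.sum_congr rfl fun c _ => ?_
  rw [integral_const_mul, integral_indicator₀ (hs c)]

/-- Distinct coordinates of a product measure are independent. Independence is applied within each
pair, then between the two pairs, and the result is reassociated. -/
theorem measurePreserving_quad_eval {κ α : Type*} [Fintype κ] [MeasurableSpace α]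
    (ν : κ → Measure α) [∀ k, IsProbabilityMeasure (ν k)] {c : κ × κ × κ × κ}
    (hc : PairwiseNe c) :
    MeasurePreserving (fun ω : κ → α => mapQuad ω c) (Measure.pi ν) (quadMeasure ν c) := by
  obtain ⟨a, b, c, d⟩ := c
  obtain ⟨hab, hac, had, hbc, hbd, hcd⟩ := hc
  dsimp only at *
  have hm : ∀ k, Measurable fun ω : κ → α => ω k := measurable_pi_apply
  have hmap : ∀ k, (Measure.pi ν).map (fun ω => ω k) = ν k := fun k =>
    (measurePreserving_eval ν k).map_eq
  have hind : ProbabilityTheory.iIndepFun (fun k (ω : κ → α) => ω k) (Measure.pi ν) :=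
    ProbabilityTheory.iIndepFun_pi (X := fun _ => id) fun _ => aemeasurable_id
  have h2 : ∀ i j, i ≠ j → (Measure.pi ν).map (fun ω => (ω i, ω j)) = (ν i).prod (ν j) := by
    intro i j hij
    rw [(ProbabilityTheory.indepFun_iff_map_prod_eq_prod_map_map (hm i).aemeasurable
      (hm j).aemeasurable).1 (hind.indepFun hij), hmap, hmap]
  have h4 : MeasurePreserving (fun ω : κ → α => ((ω a, ω b), (ω c, ω d))) (Measure.pi ν)
      (((ν a).prod (ν b)).prod ((ν c).prod (ν d))) := by
    refine ⟨by fun_prop, ?_⟩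
    rw [(ProbabilityTheory.indepFun_iff_map_prod_eq_prod_map_map (by fun_prop) (by fun_prop)).1
      (hind.indepFun_prodMk_prodMk hm a b c d hac had hbc hbd), h2 _ _ hab, h2 _ _ hcd]
  exact (measurePreserving_prodAssoc (ν a) (ν b) ((ν c).prod (ν d))).comp h4

/-- Choosing independent random points `ω k` with laws `ν k`, some outcome makes a nonnegative
weighted count of the quadruples landing in `A` at most its mean, up to the weight of the
quadruples with a repeated entry. -/
theorem exists_sum_indicator_le {κ α : Type*} [Fintype κ] [MeasurableSpace α]
    (ν : κ → Measure α) [∀ k, IsProbabilityMeasure (ν k)] (m : κ × κ × κ × κ → ℝ)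
    (hm : ∀ c, 0 ≤ m c) {A : Set (α × α × α × α)}
    (hA : ∀ c, NullMeasurableSet A (quadMeasure ν c)) :
    ∃ ω : κ → α, ∑ c, A.indicator 1 (mapQuad ω c) * m c ≤
      ∑ c, (quadMeasure ν c).real A * m c + ∑ c, {c | PairwiseNe c}ᶜ.indicator 1 c * m c := by
  classical
  -- With a repeated entry the sampled points coincide and independence fails, so the indicator is
  -- replaced by its trivial bound 1.
  let F : κ × κ × κ × κ → (κ → α) → ℝ := fun c ω =>
    if PairwiseNe c then ((fun ω : κ → α => mapQuad ω c) ⁻¹' A).indicator 1 ω else 1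
  have hset : ∀ c, PairwiseNe c →
      NullMeasurableSet ((fun ω : κ → α => mapQuad ω c) ⁻¹' A) (Measure.pi ν) := fun c hc =>
    (hA c).preimage (measurePreserving_quad_eval ν hc).quasiMeasurePreserving
  have hF : ∀ c, Integrable (F c) (Measure.pi ν) := by
    intro c
    by_cases hc : PairwiseNe c
    · simp only [F, hc, if_true]
      exact (integrable_const (1 : ℝ)).indicator₀ (hset c hc)
    · simp only [F, hc, if_false]
      exact integrable_const _
  have hint : ∀ c, ∫ ω, F c ω ∂Measure.pi ν ≤
      (quadMeasure ν c).real A + {c | PairwiseNe c}ᶜ.indicator 1 c := by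
    intro c
    by_cases hc : PairwiseNe c
    · simp only [F, hc, if_true]
      have := integral_indicator₀ (μ := Measure.pi ν) (f := fun _ => (1 : ℝ)) (hset c hc)
      have h1 : (1 : (κ → α) → ℝ) = fun _ => 1 := rfl
      rw [h1, this, setIntegral_const, smul_eq_mul, mul_one,
        indicator_of_notMem (by simpa using hc), add_zero, measureReal_def, measureReal_def,
        (measurePreserving_quad_eval ν hc).measure_preimage (hA c)]
    · simp only [F, hc, if_false]
      rw [indicator_of_mem (by simpa using hc)]
      simp
  -- First moment method: some outcome does not exceed the mean.
  obtain ⟨ω, hω⟩ := exists_le_integral (μ := Measure.pi ν) (f := fun ω => ∑ c, F c ω * m c)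
    (integrable_finsetSum _ fun c _ => (hF c).mul_const _)
  refine ⟨ω, le_trans (Finset.sum_le_sum fun c _ => ?_) (hω.trans ?_)⟩
  · refine mul_le_mul_of_nonneg_right ?_ (hm c)
    by_cases hc : PairwiseNe c
    · simp only [F, hc, if_true]
      exact le_rfl
    · simp only [F, hc, if_false]
      exact indicator_le_self' (f := fun _ => (1 : ℝ)) (by simp) _
  · rw [integral_finsetSum _ fun c _ => (hF c).mul_const _, ← Finset.sum_add_distrib]
    refine Finset.sum_le_sum fun c _ => ?_
    rw [integral_mul_const, ← add_mul]
    exact mul_le_mul_of_nonneg_right (hint c) (hm c)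

/-! ### Bins and the rarity of collisions -/

/-- The index of the interval `[k/N, (k+1)/N)` containing a point of the unit interval. -/
def bin (N : ℕ) (x : I) : Fin (N + 1) :=
  ⟨⌊(x : ℝ) * N⌋₊, Nat.lt_succ_of_le (Nat.floor_le_of_le
    (mul_le_of_le_one_left (Nat.cast_nonneg N) x.2.2))⟩

theorem measurable_bin (N : ℕ) : Measurable (bin N) := by
  refine measurable_to_countable' fun k => ?_
  have : bin N ⁻¹' {k} = (fun x : I => ⌊(x : ℝ) * N⌋₊) ⁻¹' {(k : ℕ)} := by
    ext x
    simp [bin, Fin.ext_iff]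
  rw [this]
  exact (Nat.measurable_floor.comp (by fun_prop)) (measurableSet_singleton _)

theorem volume_bin_preimage_le {N : ℕ} (hN : 0 < N) (k : Fin (N + 1)) :
    volume {y : I | bin N y = k} ≤ ENNReal.ofReal (1 / N) := by
  have hN' : (0 : ℝ) < N := Nat.cast_pos.2 hN
  rw [unitInterval.volume_apply]
  refine (measure_mono (t := Icc ((k : ℕ) / (N : ℝ)) (((k : ℕ) + 1) / (N : ℝ))) ?_).trans ?_
  · rintro _ ⟨y, rfl, rfl⟩
    have h0 : (0 : ℝ) ≤ y * N := mul_nonneg y.2.1 hN'.le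
    constructor
    · rw [div_le_iff₀ hN']
      exact Nat.floor_le h0
    · rw [le_div_iff₀ hN']
      exact (Nat.lt_floor_add_one _).le
  · rw [Real.volume_Icc, ← sub_div, add_sub_cancel_left]

theorem volume_bin_eq_le {N : ℕ} (hN : 0 < N) :
    volume {p : I × I | bin N p.1 = bin N p.2} ≤ ENNReal.ofReal (1 / N) := by
  have hs : MeasurableSet {p : I × I | bin N p.1 = bin N p.2} :=
    measurableSet_eq_fun ((measurable_bin N).comp measurable_fst)
      ((measurable_bin N).comp measurable_snd)
  rw [Measure.volume_eq_prod, Measure.prod_apply hs]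
  calc ∫⁻ x : I, volume (Prod.mk x ⁻¹' {p : I × I | bin N p.1 = bin N p.2})
      ≤ ∫⁻ _ : I, ENNReal.ofReal (1 / N) := by
        refine lintegral_mono fun x => ?_
        refine (measure_mono ?_).trans (volume_bin_preimage_le hN (bin N x))
        intro y hy
        exact Eq.symm hy
    _ = ENNReal.ofReal (1 / N) := by simp

/-- Union bound over the six pairs of coordinates: each pair projects to the square preserving
measure, and two points share a bin with probability at most `1 / N`. -/
theorem volume_real_not_pairwiseNe_bin_le {N : ℕ} (hN : 0 < N) :
    volume.real {q : I × I × I × I | ¬ PairwiseNe (mapQuad (bin N) q)} ≤ 6 / N := by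
  set E : Set (I × I) := {p | bin N p.1 = bin N p.2} with hE
  have hs : NullMeasurableSet E volume :=
    (measurableSet_eq_fun ((measurable_bin N).comp measurable_fst)
      ((measurable_bin N).comp measurable_snd)).nullMeasurableSet
  have key : ∀ f : I × I × I × I → I × I, MeasurePreserving f volume volume →
      volume.real (f ⁻¹' E) ≤ 1 / N := by
    intro f hf
    rw [measureReal_def, hf.measure_preimage hs]
    exact ENNReal.toReal_le_of_le_ofReal (by positivity) (volume_bin_eq_le hN)
  have id1 : MeasurePreserving (id : I → I) volume volume := MeasurePreserving.id _
  have a1 : MeasurePreserving (Prod.fst : I × I × I → I) volume volume :=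
    measurePreserving_fst
  have a2 : MeasurePreserving (Prod.snd : I × I × I → I × I) volume volume :=
    measurePreserving_snd
  have a3 : MeasurePreserving (Prod.snd : I × I × I × I → I × I × I) volume volume :=
    measurePreserving_snd
  have b1 : MeasurePreserving (Prod.fst : I × I → I) volume volume := measurePreserving_fst
  have b2 : MeasurePreserving (Prod.snd : I × I → I) volume volume := measurePreserving_snd
  have h12 := key _ (id1.prod a1)
  have h13 := key _ (id1.prod (b1.comp a2))
  have h14 := key _ (id1.prod (b2.comp a2))
  have h23 := key _ ((id1.prod b1).comp a3)
  have h24 := key _ ((id1.prod b2).comp a3)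
  have h34 := key _ (a2.comp a3)
  have hsub : {q : I × I × I × I | ¬ PairwiseNe (mapQuad (bin N) q)} ⊆
      (((((Prod.map id Prod.fst ⁻¹' E) ∪ (Prod.map id (Prod.fst ∘ Prod.snd) ⁻¹' E)) ∪
        (Prod.map id (Prod.snd ∘ Prod.snd) ⁻¹' E)) ∪ ((Prod.map id Prod.fst ∘ Prod.snd) ⁻¹' E)) ∪
        ((Prod.map id Prod.snd ∘ Prod.snd) ⁻¹' E)) ∪ ((Prod.snd ∘ Prod.snd) ⁻¹' E) := by
    intro q hq
    simp only [PairwiseNe, mapQuad, mem_ofPred_eq, hE, mem_union, mem_preimage, Prod.map,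
      Function.comp, id] at hq ⊢
    tauto
  refine (measureReal_mono hsub).trans ?_
  refine (measureReal_union_le _ _).trans ?_
  refine (add_le_add_left (measureReal_union_le _ _) _).trans ?_
  refine (add_le_add_left (add_le_add_left (measureReal_union_le _ _) _) _).trans ?_
  refine (add_le_add_left (add_le_add_left (add_le_add_left (measureReal_union_le _ _) _) _)
    _).trans ?_
  refine (add_le_add_left (add_le_add_left (add_le_add_left (add_le_add_left
    (measureReal_union_le _ _) _) _) _) _).trans ?_
  have : (6 : ℝ) / N = 1 / N + 1 / N + 1 / N + 1 / N + 1 / N + 1 / N := by ring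
  rw [this]
  gcongr

/-! ### Integrating over the cells of the partition -/

/-- `W(x₁,x₂) W(x₃,x₄)`. -/
def Graphon.pairWeight (W : Graphon) (q : I × I × I × I) : ℝ :=
  W q.1 q.2.1 * W q.2.2.1 q.2.2.2

theorem Graphon.pairWeight_nonneg (W : Graphon) (q : I × I × I × I) : 0 ≤ W.pairWeight q :=
  mul_nonneg (W.mem_Icc' _ _).1 (W.mem_Icc' _ _).1

theorem Graphon.pairWeight_le_one (W : Graphon) (q : I × I × I × I) : W.pairWeight q ≤ 1 :=
  mul_le_one₀ (W.mem_Icc' _ _).2 (W.mem_Icc' _ _).1 (W.mem_Icc' _ _).2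

theorem Graphon.integrable_pairWeight (W : Graphon) : Integrable W.pairWeight volume := by
  have h12 : MeasurePreserving (fun q : I × I × I × I => (q.1, q.2.1)) volume volume :=
    (MeasurePreserving.id (volume : Measure I)).prod
      (measurePreserving_fst (μ := (volume : Measure I)) (ν := (volume : Measure (I × I))))
  have ha : MeasurePreserving (fun q : I × I × I × I => q.2) volume volume :=
    measurePreserving_snd
  have hb : MeasurePreserving (fun q : I × I × I => q.2) volume volume := measurePreserving_snd
  have hm : AEMeasurable W.pairWeight volume :=
    (W.aemeasurable'.comp_quasiMeasurePreserving h12.quasiMeasurePreserving).mul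
      (W.aemeasurable'.comp_quasiMeasurePreserving (hb.comp ha).quasiMeasurePreserving)
  refine Integrable.of_bound hm.aestronglyMeasurable 1 (Filter.Eventually.of_forall fun q => ?_)
  rw [Real.norm_of_nonneg (W.pairWeight_nonneg q)]
  exact W.pairWeight_le_one q

theorem mapQuad_preimage_singleton {α β : Type*} (f : α → β) (c : β × β × β × β) :
    mapQuad f ⁻¹' {c} = (f ⁻¹' {c.1}) ×ˢ (f ⁻¹' {c.2.1}) ×ˢ (f ⁻¹' {c.2.2.1}) ×ˢ
      (f ⁻¹' {c.2.2.2}) := by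
  ext q
  simp [mapQuad, Prod.ext_iff]

theorem UnitPartition.index_preimage_singleton {n : ℕ} (P : UnitPartition n) (i : Fin n) :
    P.index ⁻¹' {i} = P.part i := by
  ext x
  simp [P.index_eq_iff]

theorem Graphon.setIntegral_pairWeight (W : Graphon) (s t u v : Set I) :
    ∫ q in s ×ˢ t ×ˢ u ×ˢ v, W.pairWeight q =
      (∫ p in s ×ˢ t, W p.1 p.2) * ∫ p in u ×ˢ v, W p.1 p.2 := by
  have h := setIntegral_prod_mul (μ := (volume : Measure (I × I)))
    (ν := (volume : Measure (I × I))) (fun p => W p.1 p.2) (fun p => W p.1 p.2)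
    (s ×ˢ t) (u ×ˢ v)
  rw [← h, ← (volume_preserving_prodAssoc (α₁ := I) (β₁ := I)
    (γ₁ := I × I)).setIntegral_preimage_emb MeasurableEquiv.prodAssoc.measurableEmbedding]
  congr 2
  ext q
  simp [MeasurableEquiv.prodAssoc, and_assoc]

/-- On a null cell both sides vanish, so the default value of the average there is harmless. -/
theorem Graphon.setIntegral_part_prod (W : Graphon) {n : ℕ} (P : UnitPartition n) (i j : Fin n) :
    ∫ p in P.part i ×ˢ P.part j, W p.1 p.2 =
      W.cellAverage P i j * (volume.real (P.part i) * volume.real (P.part j)) := by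
  rw [Graphon.cellAverage]
  by_cases h : volume.real (P.part i) * volume.real (P.part j) = 0
  · rw [h, mul_zero]
    apply setIntegral_measure_zero
    rw [← measureReal_eq_zero_iff, Measure.volume_eq_prod, measureReal_prod_prod, h]
  · rw [div_mul_cancel₀ _ h]

/-- Normalized Lebesgue measure on a set of the unit interval. -/
theorem exists_normalized_restrict (s : Set I) :
    ∃ ν : Measure I, IsProbabilityMeasure ν ∧ ν ≪ volume ∧
      volume.restrict s = volume s • ν := by
  by_cases h : volume s = 0
  · refine ⟨volume, inferInstance, Measure.AbsolutelyContinuous.rfl, ?_⟩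
    rw [h, zero_smul, Measure.restrict_eq_zero.2 h]
  · refine ⟨ProbabilityTheory.cond volume s, ProbabilityTheory.cond_isProbabilityMeasure h,
      ProbabilityTheory.cond_absolutelyContinuous, ?_⟩
    rw [ProbabilityTheory.cond, smul_smul, ENNReal.mul_inv_cancel h (measure_ne_top _ _),
      one_smul]

theorem volume_real_inter_cell {n : ℕ} (P : UnitPartition n) (ν : Fin n → Measure I)
    [∀ i, IsProbabilityMeasure (ν i)]
    (hν : ∀ i, volume.restrict (P.part i) = volume (P.part i) • ν i)
    (A : Set (I × I × I × I)) (i : Fin n × Fin n × Fin n × Fin n) :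
    volume.real (mapQuad P.index ⁻¹' {i} ∩ A) =
      volume.real (P.part i.1) * volume.real (P.part i.2.1) *
        (volume.real (P.part i.2.2.1) * volume.real (P.part i.2.2.2)) *
        (quadMeasure ν i).real A := by
  have hnull : NullMeasurableSet (mapQuad P.index ⁻¹' {i}) volume :=
    (aemeasurable_mapQuad P.aemeasurable_index).nullMeasurable (measurableSet_singleton i)
  have hr : (volume : Measure (I × I × I × I)).restrict (mapQuad P.index ⁻¹' {i}) =
      (volume (P.part i.1) * (volume (P.part i.2.1) *
        (volume (P.part i.2.2.1) * volume (P.part i.2.2.2)))) • quadMeasure ν i := by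
    rw [mapQuad_preimage_singleton]
    simp only [P.index_preimage_singleton, Measure.volume_eq_prod, ← Measure.prod_restrict, hν,
      Measure.prod_smul_left, Measure.prod_smul_right, smul_smul, quadMeasure]
    congr 1
    ring
  have := Measure.restrict_apply₀' (t := A) hnull
  rw [hr] at this
  rw [inter_comm, measureReal_def, ← this, measureReal_def]
  simp only [measureReal_def, Measure.smul_apply, smul_eq_mul, ENNReal.toReal_mul]
  ring

/-- The density of `A` weighted by the stepped graphon, computed cell by cell. -/
theorem Graphon.pairDensity_average (W : Graphon) {n : ℕ} (P : UnitPartition n)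
    (ν : Fin n → Measure I) [∀ i, IsProbabilityMeasure (ν i)]
    (hν : ∀ i, volume.restrict (P.part i) = volume (P.part i) • ν i)
    {A : Set (I × I × I × I)} (hA : NullMeasurableSet A volume) :
    (W.average P).pairDensity A =
      1 / 8 * ∫ q, W.pairWeight q * (quadMeasure ν (mapQuad P.index q)).real A := by
  have hL : AEMeasurable (mapQuad P.index) (volume : Measure (I × I × I × I)) :=
    aemeasurable_mapQuad P.aemeasurable_index
  rw [integral_mul_comp_eq_sum W.integrable_pairWeight hL fun i => (quadMeasure ν i).real A]
  have h1 : Integrable (A.indicator (1 : I × I × I × I → ℝ)) volume :=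
    (integrable_const (1 : ℝ)).indicator₀ hA
  have h2 := integral_mul_comp_eq_sum h1 hL
    fun i => W.cellAverage P i.1 i.2.1 * W.cellAverage P i.2.2.1 i.2.2.2
  rw [Graphon.pairDensity]
  congr 1
  calc _ = ∫ q, A.indicator (1 : I × I × I × I → ℝ) q *
        (W.cellAverage P (mapQuad P.index q).1 (mapQuad P.index q).2.1 *
        W.cellAverage P (mapQuad P.index q).2.2.1 (mapQuad P.index q).2.2.2) :=
        integral_congr_ae (Filter.Eventually.of_forall fun q => mul_comm _ _)
    _ = _ := by
      rw [h2]
      refine Finset.sum_congr rfl fun i _ => ?_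
      have h3 : (1 : I × I × I × I → ℝ) = fun _ => 1 := rfl
      have h4 : (volume.restrict (mapQuad P.index ⁻¹' {i})).real A =
          volume.real (mapQuad P.index ⁻¹' {i} ∩ A) := by
        rw [measureReal_def, Measure.restrict_apply₀'
          (hL.nullMeasurable (measurableSet_singleton i)), inter_comm, measureReal_def]
      rw [h3, integral_indicator₀ (hA.mono_ac Measure.absolutelyContinuous_restrict),
        setIntegral_const, smul_eq_mul, mul_one, h4, volume_real_inter_cell P ν hν, mapQuad_preimage_singleton]
      simp only [P.index_preimage_singleton]
      rw [W.setIntegral_pairWeight, W.setIntegral_part_prod, W.setIntegral_part_prod]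
      ring

/-- Every null measurable set of quadruples can be pulled back along a map with finitely many
values so that its density with respect to `W` exceeds that with respect to the stepped graphon
by an arbitrarily small amount. -/
theorem Graphon.exists_pairDensity_preimage_le (W : Graphon) {n : ℕ} (P : UnitPartition n)
    {A : Set (I × I × I × I)} (hA : NullMeasurableSet A volume) {N : ℕ} (hN : 0 < N) :
    ∃ (l : I → Fin (N + 1) × Fin n) (ω : Fin (N + 1) × Fin n → I), AEMeasurable l volume ∧
      W.pairDensity (mapQuad (ω ∘ l) ⁻¹' A) ≤ (W.average P).pairDensity A + 1 / N := by
  choose ν hprob hac hν using fun i => exists_normalized_restrict (P.part i)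
  let l : I → Fin (N + 1) × Fin n := fun x => (bin N x, P.index x)
  have hl : AEMeasurable l volume := (measurable_bin N).aemeasurable.prodMk P.aemeasurable_index
  have hL : AEMeasurable (mapQuad l) (volume : Measure (I × I × I × I)) :=
    aemeasurable_mapQuad hl
  -- The law ignores the bin: points are spread over the whole part, which is what averages `W` over
  -- cells.
  let ν' : Fin (N + 1) × Fin n → Measure I := fun k => ν k.2
  -- `A` is only measurable up to `volume`-null sets; absolute continuity carries this over to the
  -- sampling laws.
  have hac' : ∀ c, quadMeasure ν' c ≪ volume := fun c =>
    (hac _).prod ((hac _).prod ((hac _).prod (hac _)))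
  obtain ⟨ω, hω⟩ := exists_sum_indicator_le ν'
    (fun c => ∫ q in mapQuad l ⁻¹' {c}, W.pairWeight q)
    (fun c => integral_nonneg W.pairWeight_nonneg) fun c => hA.mono_ac (hac' c)
  refine ⟨l, ω, hl, ?_⟩
  rw [← integral_mul_comp_eq_sum W.integrable_pairWeight hL,
    ← integral_mul_comp_eq_sum W.integrable_pairWeight hL,
    ← integral_mul_comp_eq_sum W.integrable_pairWeight hL] at hω
  have herr : ∫ q, W.pairWeight q *
      {c | PairwiseNe c}ᶜ.indicator 1 (mapQuad l q) ≤ 6 / N := by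
    have hB : NullMeasurableSet (mapQuad l ⁻¹' {c | PairwiseNe c}ᶜ) volume :=
      hL.nullMeasurable (to_countable _).measurableSet
    calc _ ≤ ∫ q, (mapQuad l ⁻¹' {c | PairwiseNe c}ᶜ).indicator (fun _ => (1 : ℝ)) q :=
          integral_mono_of_nonneg
            (Filter.Eventually.of_forall fun q => mul_nonneg (W.pairWeight_nonneg q)
              (indicator_nonneg (fun _ _ => zero_le_one) _))
            ((integrable_const (1 : ℝ)).indicator₀ hB)
            (Filter.Eventually.of_forall fun q => mul_le_of_le_one_left
              (indicator_nonneg (fun _ _ => zero_le_one) _) (W.pairWeight_le_one q))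
      _ = volume.real (mapQuad l ⁻¹' {c | PairwiseNe c}ᶜ) := by
          rw [integral_indicator₀ hB, setIntegral_const, smul_eq_mul, mul_one]
      _ ≤ volume.real {q : I × I × I × I | ¬ PairwiseNe (mapQuad (bin N) q)} := by
          -- Distinct bins force distinct labels.
          refine measureReal_mono fun q hq hne => hq ?_
          obtain ⟨h1, h2, h3, h4, h5, h6⟩ := hne
          exact ⟨fun h => h1 (congrArg Prod.fst h), fun h => h2 (congrArg Prod.fst h),
            fun h => h3 (congrArg Prod.fst h), fun h => h4 (congrArg Prod.fst h),
            fun h => h5 (congrArg Prod.fst h), fun h => h6 (congrArg Prod.fst h)⟩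
      _ ≤ 6 / N := volume_real_not_pairwiseNe_bin_le hN
  rw [W.pairDensity_average P ν hν hA]
  have hle : W.pairDensity (mapQuad (ω ∘ l) ⁻¹' A) =
      1 / 8 * ∫ q, W.pairWeight q * A.indicator 1 (mapQuad ω (mapQuad l q)) := rfl
  have hN' : (0 : ℝ) < N := Nat.cast_pos.2 hN
  have h6 : (1 : ℝ) / 8 * (6 / N) ≤ 1 / N := by
    rw [show (1 : ℝ) / 8 * (6 / N) = 6 / 8 * (1 / N) by ring]
    exact mul_le_of_le_one_left (by positivity) (by norm_num)
  have hmid : ∫ q, W.pairWeight q * (quadMeasure ν' (mapQuad l q)).real A =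
      ∫ q, W.pairWeight q * (quadMeasure ν (mapQuad P.index q)).real A := rfl
  rw [hle]
  linarith

/-! ### Measurability and pullback of drawings -/

/-- The set of quadruples of points for which the segments spanned by the first two and by the
last two points meet is closed. -/
theorem isClosed_segments_meet : IsClosed {q : Plane × Plane × Plane × Plane |
    (convexHull ℝ {q.1, q.2.1} ∩ convexHull ℝ {q.2.2.1, q.2.2.2}).Nonempty} := by
  -- Coincidences of points at parameters `(s, t)` form a closed set, and projecting away the
  -- compact factor `I × I` keeps it closed.
  let C : Set ((I × I) × (Plane × Plane × Plane × Plane)) :=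
    {z | AffineMap.lineMap z.2.1 z.2.2.1 (z.1.1 : ℝ) =
      AffineMap.lineMap z.2.2.2.1 z.2.2.2.2 (z.1.2 : ℝ)}
  have hC : IsClosed C := by
    refine isClosed_eq ?_ ?_ <;>
    · simp only [AffineMap.lineMap_apply_module]
      fun_prop
  have himg := isClosedMap_snd_of_compactSpace (X := I × I) _ hC
  convert himg using 1
  ext ⟨a, b, c, d⟩
  simp only [convexHull_pair, segment_eq_image_lineMap, mem_image, C]
  constructor
  · rintro ⟨p, ⟨s, hs, rfl⟩, t, ht, h⟩
    exact ⟨((⟨s, hs⟩, ⟨t, ht⟩), (a, b, c, d)), h.symm, rfl⟩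
  · rintro ⟨⟨⟨s, t⟩, q⟩, h, rfl⟩
    exact ⟨_, ⟨s, s.2, rfl⟩, t, t.2, Eq.symm h⟩

theorem RectilinearDrawing.nullMeasurableSet_meetSet (f : RectilinearDrawing) :
    NullMeasurableSet f.meetSet volume :=
  (aemeasurable_mapQuad f.aemeasurable').nullMeasurable isClosed_segments_meet.measurableSet

/-- The rectilinear drawing pulled back along a map with countably many values. -/
def RectilinearDrawing.pullback (f : RectilinearDrawing) {κ : Type*} [Countable κ]
    [MeasurableSpace κ] [MeasurableSingletonClass κ] {l : I → κ} (hl : AEMeasurable l volume)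
    (ω : κ → I) : RectilinearDrawing where
  toFun := f.toFun ∘ ω ∘ l
  aemeasurable' := (measurable_of_countable (f.toFun ∘ ω)).comp_aemeasurable hl
  bounded' := f.bounded'.subset (range_comp_subset_range _ _)

/-- The simple graphon drawing pulled back along an arbitrary map. -/
def SimpleGraphonDrawing.pullback (D : SimpleGraphonDrawing) (φ : I → I) :
    SimpleGraphonDrawing where
  curve x y := D.curve (φ x) (φ y)
  simple_or_const _ _ := D.simple_or_const _ _
  reverse _ _ := D.reverse _ _
  diag _ := D.diag _
  start _ _ := D.start _ _
  meet _ _ _ _ := D.meet _ _ _ _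

/-- The meeting set is a preimage under the label map of a subset of a countable discrete space, so
it is measurable whatever `D` is. -/
theorem SimpleGraphonDrawing.nullMeasurableSet_meetSet_pullback (D : SimpleGraphonDrawing)
    {κ : Type*} [Countable κ] [MeasurableSpace κ] [MeasurableSingletonClass κ] {l : I → κ}
    (hl : AEMeasurable l volume) (ω : κ → I) :
    NullMeasurableSet (D.pullback (ω ∘ l)).meetSet volume :=
  (aemeasurable_mapQuad hl).nullMeasurable (s := mapQuad ω ⁻¹' D.meetSet)
    (to_countable _).measurableSet

theorem Graphon.pairDensity_nonneg (W : Graphon) (A : Set (I × I × I × I)) :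
    0 ≤ W.pairDensity A :=
  mul_nonneg (by norm_num) (integral_nonneg fun _ =>
    mul_nonneg (mul_nonneg (W.mem_Icc' _ _).1 (W.mem_Icc' _ _).1)
      (indicator_nonneg (fun _ _ => zero_le_one) _))

theorem iInf_le_iInf_of_approx {ι : Type*} {F G : ι → ℝ} (hF : BddBelow (range F))
    (h : ∀ i, ∀ N : ℕ, 0 < N → ∃ j, F j ≤ G i + 1 / N) : ⨅ i, F i ≤ ⨅ i, G i := by
  cases isEmpty_or_nonempty ι
  -- An empty real infimum is 0 by convention, on both sides.
  · simp [Real.iInf_of_isEmpty]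
  · refine le_ciInf fun i => le_of_forall_pos_le_add fun ε hε => ?_
    obtain ⟨N, hN⟩ := exists_nat_one_div_lt hε
    obtain ⟨j, hj⟩ := h i (N + 1) N.succ_pos
    push_cast at hj
    exact (ciInf_le hF j).trans (by linarith)

end

theorem mainTheorem10 (W : Graphon) {n : ℕ} (P : UnitPartition n) :
    W.rectilinearCrossingDensity ≤ (W.average P).rectilinearCrossingDensity ∧
      W.crossingDensity ≤ (W.average P).crossingDensity := by
  constructor
  · refine iInf_le_iInf_of_approx ⟨0, ?_⟩ fun f N hN => ?_
    · rintro _ ⟨f, rfl⟩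
      exact W.pairDensity_nonneg _
    · obtain ⟨l, ω, hl, h⟩ :=
        W.exists_pairDensity_preimage_le P f.nullMeasurableSet_meetSet hN
      exact ⟨f.pullback hl ω, h⟩
  · refine iInf_le_iInf_of_approx ⟨0, ?_⟩ fun D N hN => ?_
    · rintro _ ⟨D, rfl⟩
      exact W.pairDensity_nonneg _
    · obtain ⟨l, ω, hl, h⟩ := W.exists_pairDensity_preimage_le P D.2 hN
      exact ⟨⟨D.1.pullback (ω ∘ l), D.1.nullMeasurableSet_meetSet_pullback hl ω⟩, h⟩
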